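/- Let $\mathcal D$ be an infinite-dimensional dense linear subspace of a complex Hilbert space $\mathcal H$. Let $\mathcal L^+(\mathcal D)$ be the $*$-algebra of all linear operators $A:\mathcal D\to\mathcal D$ with $A^*\mathcal D\subset\mathcal D$ (in particular $\mathcal D\subset\operatorname{dom}A^*$), with involution $A\mapsto A^+=A^*|_{\mathcal D}$. Assume that $\mathcal D$ is an (F)-domain, i.e. that $\mathcal D$ with the locally convex topology generated by the seminorms $\varphi\mapsto\|A\varphi\|$, $A\in\mathcal L^+(\mathcal D)$, is metrizable and complete. A standard $*$-operator algebra on $\mathcal D$ is a (not necessarily unital) $*$-subalgebra of $\mathcal L^+(\mathcal D)$ that contains all finite rank operators belonging to $\mathcal L^+(\mathcal D)$. **Theorem 2.1.** Let $\mathcal A,\mathcal B$ be standard $*$-operator algebras on $\mathcal D$, and let $\Phi:\mathcal A\to\mathcal B$ be an additive bijection that preserves zero products: $XY=0$ implies $\Phi(X)\Phi(Y)=0$ for $X,Y\in\mathcal A$. Then there are $c\in\mathbb C$ and a bijection $T:\mathcal D\to\mathcal D$, either linear or conjugate linear, such that $$\Phi(A)=c\,TAT^{-1}\qquad(A\in\mathcal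 A),$$ and if $T$ is linear, then $T\in\mathcal L^+(\mathcal D)$. Moreover $A\mapsto TAT^{-1}$ is a ring isomorphism of $\mathcal A$ onto $\mathcal B$, so $\Phi$ is a scalar multiple of a ring isomorphism. -/

import Mathlib

namespace UnboundedOp

section Basics

variable {H : Type*} [NormedAddCommGroup H] [InnerProductSpace ℂ H]

/-- `L⁺(D)`: the linear operators `A : D → D` (so `A D ⊆ D`) such that `A* D ⊆ D`. The last condition
is spelled out: every `φ ∈ D` lies in the domain of `A*` and `η = A* φ` lies in `D`, that is,
`⟪η, χ⟫ = ⟪φ, A χ⟫` for all `χ` in `D`, the domain of `A`.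
The inner product is conjugate linear in the first variable. -/
def LPlus (D : Submodule ℂ H) : Subalgebra ℂ (Module.End ℂ D) where
  carrier := {A | ∀ φ : D, ∃ η : D, ∀ χ : D, inner ℂ (η : H) (χ : H) = inner ℂ (φ : H) (A χ : H)}
  mul_mem' := by
    intro A B hA hB φ
    obtain ⟨η, hη⟩ := hA φ
    obtain ⟨ζ, hζ⟩ := hB η
    exact ⟨ζ, fun χ => by rw [hζ, hη]; rfl⟩
  add_mem' := by
    intro A B hA hB φ
    obtain ⟨η, hη⟩ := hA φ
    obtain ⟨ζ, hζ⟩ := hB φ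
    exact ⟨η + ζ, fun χ => by
      rw [Submodule.coe_add, inner_add_left, hη, hζ, ← inner_add_right, LinearMap.add_apply,
        Submodule.coe_add]⟩
  algebraMap_mem' := by
    intro c φ
    exact ⟨(starRingEnd ℂ) c • φ, fun χ => by
      rw [Module.algebraMap_end_apply, Submodule.coe_smul, Submodule.coe_smul, inner_smul_left,
        inner_smul_right, Complex.conj_conj]⟩

variable {D : Submodule ℂ H}

theorem ext_inner_domain {η ζ : D}
    (h : ∀ χ : D, inner ℂ (η : H) (χ : H) = inner ℂ (ζ : H) (χ : H)) : η = ζ := by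
  have h2 : ∀ χ : D, inner ℂ η χ = inner ℂ ζ χ := h
  exact ext_inner_right ℂ h2

/-- The restriction of `A*` to `D`, as a linear map on `D`. -/
noncomputable def adjointFun (A : LPlus D) : Module.End ℂ D where
  toFun φ := (A.2 φ).choose
  map_add' φ ψ := ext_inner_domain fun χ => by
    rw [(A.2 (φ + ψ)).choose_spec χ, Submodule.coe_add, Submodule.coe_add, inner_add_left,
      inner_add_left, (A.2 φ).choose_spec χ, (A.2 ψ).choose_spec χ]
  map_smul' c φ := ext_inner_domain fun χ => by
    rw [(A.2 (c • φ)).choose_spec χ, RingHom.id_apply, Submodule.coe_smul, Submodule.coe_smul,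
      inner_smul_left, inner_smul_left, (A.2 φ).choose_spec χ]

theorem adjointFun_inner (A : LPlus D) (φ χ : D) :
    inner ℂ (adjointFun A φ : H) (χ : H) = inner ℂ (φ : H) ((A : Module.End ℂ D) χ : H) :=
  (A.2 φ).choose_spec χ

theorem adjointFun_mem (A : LPlus D) : adjointFun A ∈ LPlus D := fun φ =>
  ⟨(A : Module.End ℂ D) φ, fun χ => by
    rw [← inner_conj_symm, ← adjointFun_inner, inner_conj_symm]⟩

theorem eq_adjointFun {A : LPlus D} {B : Module.End ℂ D}
    (h : ∀ φ χ : D, inner ℂ (B φ : H) (χ : H) = inner ℂ (φ : H) ((A : Module.End ℂ D) χ : H)) :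
    adjointFun A = B :=
  LinearMap.ext fun φ => ext_inner_domain fun χ => by rw [adjointFun_inner, h]

/-- `L⁺(D)` is a *-algebra with the involution `A ↦ A⁺ = A*|D`. -/
noncomputable instance instStarRingLPlus : StarRing (LPlus D) where
  star A := ⟨adjointFun A, adjointFun_mem A⟩
  star_involutive A := Subtype.ext <| eq_adjointFun fun φ χ => by
    rw [← inner_conj_symm, ← adjointFun_inner, inner_conj_symm]
  star_mul A B := Subtype.ext <| eq_adjointFun fun φ χ => by
    change inner ℂ (adjointFun B (adjointFun A φ) : H) (χ : H) = _
    rw [adjointFun_inner, adjointFun_inner]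
    rfl
  star_add A B := Subtype.ext <| eq_adjointFun fun φ χ => by
    change inner ℂ ((adjointFun A φ + adjointFun B φ : D) : H) (χ : H) = _
    rw [Submodule.coe_add, inner_add_left, adjointFun_inner, adjointFun_inner, ← inner_add_right]
    rfl

theorem star_inner (A : LPlus D) (φ χ : D) :
    inner ℂ (((star A : LPlus D) : Module.End ℂ D) φ : H) (χ : H)
      = inner ℂ (φ : H) ((A : Module.End ℂ D) χ : H) :=
  adjointFun_inner A φ χ

instance instStarModuleLPlus : StarModule ℂ (LPlus D) where
  star_smul c A := Subtype.ext <| eq_adjointFun fun φ χ => by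
    change inner ℂ (((starRingEnd ℂ) c • adjointFun A φ : D) : H) (χ : H) = _
    rw [Submodule.coe_smul, inner_smul_left, adjointFun_inner, Complex.conj_conj,
      ← inner_smul_right]
    rfl

/-- A (*-) subalgebra of `L⁺(D)`, not necessarily unital, is a standard *-operator algebra on `D`
if it contains every finite rank operator of `L⁺(D)`. -/
def IsStandard (𝒜 : NonUnitalStarSubalgebra ℂ (LPlus D)) : Prop :=
  ∀ F : LPlus D, FiniteDimensional ℂ (LinearMap.range (F : Module.End ℂ D)) → F ∈ 𝒜

/-- The seminorm `φ ↦ ‖A φ‖` on `D`. -/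
noncomputable def graphSeminorm (A : LPlus D) : Seminorm ℂ D :=
  (normSeminorm ℂ D).comp (A : Module.End ℂ D)

/-- The uniform structure on `D` generated by the seminorms `φ ↦ ‖A φ‖`, `A ∈ L⁺(D)`. -/
noncomputable abbrev graphUniformSpace (D : Submodule ℂ H) : UniformSpace D :=
  ⨅ A : LPlus D, (graphSeminorm A).toSeminormedAddCommGroup.toUniformSpace

/-- The graph topology `t` on `D`. -/
noncomputable abbrev graphTopology (D : Submodule ℂ H) : TopologicalSpace D :=
  (graphUniformSpace D).toTopologicalSpace

/-- A dense linear manifold `D` is an (F)-domain if `(D, t)` is an (F)-space: the (locally convex)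
vector topology `t` is metrizable and complete. -/
structure IsFDomain (D : Submodule ℂ H) : Prop where
  dense : Dense (D : Set H)
  metrizable : @TopologicalSpace.MetrizableSpace D (graphTopology D)
  complete : @CompleteSpace D (graphUniformSpace D)

/-- Conjugate linear maps `D → D`. -/
structure IsConjLinear (T : D → D) : Prop where
  map_add : ∀ φ ψ : D, T (φ + ψ) = T φ + T ψ
  map_smul : ∀ (a : ℂ) (φ : D), T (a • φ) = (starRingEnd ℂ) a • T φ

end Basics

end UnboundedOp

/-!
Write `x ⊗ y` for the operator `χ ↦ ⟪y, χ⟫ x`. For an idempotent `E` of rank one,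
`(A E) (B - E B) = 0 = (A - A E) (E B)`, so a map `Φ` that preserves zero products satisfies
`Φ (A E) Φ B = Φ A Φ (E B)`. Every `x ⊗ y` is obtained from such idempotents by differences and products,
so the identity holds with any `S = x ⊗ y` in place of `E` (`map_mul_rankOne`). As `Φ` is onto an
algebra that contains all operators of rank one, there is an operator `L S` with
`Φ (S B) = L S * Φ B` and `Φ (A S) = Φ A * L S` (`exists_multiplier_family`), and `S ↦ L S` is
multiplicative.

Fix a unit vector `x₀`, put `P = x₀ ⊗ x₀` and `Q = L P`. All nonzero elements of the corner
`Q ℬ Q = Φ (ℂ P)` have the same kernel, which forces `Q` to have rank one. With `Q u = u ≠ 0`, the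
equation `L (a P) u = h a • u` defines a field automorphism `h` of `ℂ`, and `T x = L (x ⊗ x₀) u` is an
`h`-semilinear bijection of `D` with `Φ A T = c T A` (`exists_semilinear`).

It remains to see that `h` is the identity or the conjugation. The operators `Φ (x ⊗ x)` have
adjoints, which yields a map `S` with `h ⟪x, y⟫ = ⟪S x, T y⟫`. If `h` were discontinuous, it would be
unbounded near `0`. For an orthonormal sequence `e n`, completeness and metrizability of the graph
topology give `y = ∑ a n e n` in `D` whenever the `a n` are small enough
(`IsFDomain.exists_forall_inner_eq`), and `|h (a n)| > n ‖S (e n)‖` contradicts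
`h (a n) = ⟪S (e n), T y⟫` (`IsFDomain.ringHom_eq_id_or_conj`). Finally, if `T` is linear, then the
adjoint of `T⁻¹ (w ⊗ w) T`, a multiple of an element of `𝒜`, yields the adjoint of `T`.
-/

namespace UnboundedOp

/-! ### Operators of rank one -/

section Algebraic

variable {V : Type*} [NormedAddCommGroup V] [InnerProductSpace ℂ V]

/-- The operator `x ⊗ y : χ ↦ ⟪y, χ⟫ x`, as a plain linear map on `V`. -/
noncomputable def rankOneEnd (x y : V) : Module.End ℂ V :=
  (innerₛₗ ℂ y).smulRight x

@[simp]
theorem rankOneEnd_apply (x y χ : V) : rankOneEnd x y χ = inner ℂ y χ • x := rfl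

theorem rankOneEnd_mul (x y z w : V) :
    rankOneEnd x y * rankOneEnd z w = rankOneEnd (inner ℂ y z • x) w := by
  ext χ
  simp [smul_smul]

theorem mul_rankOneEnd (A : Module.End ℂ V) (x y : V) :
    A * rankOneEnd x y = rankOneEnd (A x) y := by
  ext χ
  simp

theorem rankOneEnd_add_left (x x' y : V) :
    rankOneEnd (x + x') y = rankOneEnd x y + rankOneEnd x' y := by
  ext χ
  simp

theorem rankOneEnd_add_right (x y y' : V) :
    rankOneEnd x (y + y') = rankOneEnd x y + rankOneEnd x y' := by
  ext χ
  simp [add_smul]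

theorem exists_ne_zero_inner_eq_zero (hinf : ¬ FiniteDimensional ℂ V) (x y : V) :
    ∃ e : V, e ≠ 0 ∧ inner ℂ x e = 0 ∧ inner ℂ y e = 0 := by
  have hfd : FiniteDimensional ℂ (Submodule.span ℂ ({x, y} : Set V)) :=
    FiniteDimensional.span_of_finite ℂ (Set.toFinite _)
  have hne : (Submodule.span ℂ ({x, y} : Set V))ᗮ ≠ ⊥ := by
    intro h
    rw [Submodule.orthogonal_eq_bot_iff] at h
    rw [h] at hfd
    exact hinf (Module.finite_def.2 (Module.Finite.iff_fg.1 hfd))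
  obtain ⟨e, he, he0⟩ := Submodule.exists_mem_ne_zero_of_ne_bot hne
  rw [Submodule.mem_orthogonal] at he
  exact ⟨e, he0, he x (Submodule.subset_span (by simp)), he y (Submodule.subset_span (by simp))⟩

/-! ### Additive maps that preserve zero products -/

variable {R : Type*} [NonUnitalRing R]

/-- An injective additive map `f` into the operators on `V` that preserves zero products, defined on
a ring `R` which acts faithfully on `V` through `α`. Both `α` and `f` reach every `x ⊗ y`. For a map
`Φ : 𝒜 → ℬ` between standard algebras, `α` is the action of `𝒜` and `f` is `Φ` followed by the action
of `ℬ`. -/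
structure IsZeroProductPreserver (α : R →ₙ+* Module.End ℂ V) (f : R →+ Module.End ℂ V) : Prop where
  injective_action : Function.Injective α
  injective : Function.Injective f
  exists_action_eq : ∀ x y : V, ∃ r, α r = rankOneEnd x y
  exists_eq : ∀ x y : V, ∃ r, f r = rankOneEnd x y
  map_mul_eq_zero : ∀ a b : R, a * b = 0 → f a * f b = 0

namespace IsZeroProductPreserver

variable {α : R →ₙ+* Module.End ℂ V} {f : R →+ Module.End ℂ V}

/-- The zero products `(a e) (b - e b)` and `(a - a e) (e b)` let an idempotent `e` move across. -/
theorem map_mul_idempotent (hf : IsZeroProductPreserver α f) {e : R} (he : e * e = e) (a b : R) :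
    f (a * e) * f b = f a * f (e * b) := by
  have h1 := hf.map_mul_eq_zero (a * e) (b - e * b) (by
    rw [mul_sub, mul_assoc a e (e * b), ← mul_assoc e e b, he, mul_assoc, sub_self])
  have h2 := hf.map_mul_eq_zero (a - a * e) (e * b) (by
    rw [sub_mul, mul_assoc a e (e * b), ← mul_assoc e e b, he, sub_self])
  rw [map_sub, mul_sub, sub_eq_zero] at h1
  rw [map_sub, sub_mul, sub_eq_zero] at h2
  rw [h1, h2]

/-- Elements of rank one may be moved across a product. An `x ⊗ y` with `⟪y, x⟫ = 0` is a difference of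
two idempotents, and any other one is a product of two of these. -/
theorem map_mul_rankOne (hf : IsZeroProductPreserver α f) (hinf : ¬ FiniteDimensional ℂ V)
    {x y : V} {s : R} (hs : α s = rankOneEnd x y) (a b : R) :
    f (a * s) * f b = f a * f (s * b) := by
  have idem : ∀ {x y : V} {s : R}, α s = rankOneEnd x y → inner ℂ y x = (1 : ℂ) → s * s = s := by
    intro x y s hs h1
    apply hf.injective_action
    rw [map_mul, hs, rankOneEnd_mul, h1, one_smul]
  have orth : ∀ {x y : V} {s : R}, α s = rankOneEnd x y → inner ℂ y x = (0 : ℂ) → ∀ a b : R,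
      f (a * s) * f b = f a * f (s * b) := by
    intro x y s hs h0 a b
    by_cases hx : x = 0
    · have : s = 0 := hf.injective_action (by
        rw [hs, map_zero, hx]; ext χ; simp)
      simp [this]
    have hxx : inner ℂ x x ≠ (0 : ℂ) := inner_self_ne_zero.2 hx
    -- `x ⊗ y = x ⊗ (z + y) - x ⊗ z`, a difference of idempotents since `⟪z, x⟫ = ⟪z + y, x⟫ = 1`
    set z : V := ((starRingEnd ℂ) (inner ℂ x x)⁻¹) • x with hz
    have hzx : inner ℂ z x = (1 : ℂ) := by
      rw [hz, inner_smul_left, Complex.conj_conj, inv_mul_cancel₀ hxx]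
    obtain ⟨e, he⟩ := hf.exists_action_eq x z
    have h1 := hf.map_mul_idempotent (idem he hzx) a b
    have h2 := hf.map_mul_idempotent (idem (s := e + s) (x := x) (y := z + y)
      (by rw [map_add, he, hs, rankOneEnd_add_right]) (by rw [inner_add_left, hzx, h0, add_zero])) a b
    rw [mul_add, add_mul, map_add, map_add, add_mul, mul_add, h1] at h2
    exact add_left_cancel h2
  -- for a vector `e` orthogonal to `x` and `y`, both factors of `x ⊗ y = (‖e‖⁻² x ⊗ e) (e ⊗ y)` are
  -- of the kind just treated
  obtain ⟨e, he0, hxe, hye⟩ := exists_ne_zero_inner_eq_zero hinf x y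
  have hee : inner ℂ e e ≠ (0 : ℂ) := inner_self_ne_zero.2 he0
  obtain ⟨p, hp⟩ := hf.exists_action_eq ((inner ℂ e e)⁻¹ • x : V) e
  obtain ⟨q, hq⟩ := hf.exists_action_eq e y
  have hpq : s = p * q := hf.injective_action (by
    rw [map_mul, hp, hq, hs, rankOneEnd_mul, smul_smul, mul_inv_cancel₀ hee, one_smul])
  have hp' := orth hp (by
    rw [inner_eq_zero_symm, inner_smul_left, hxe, mul_zero])
  have hq' := orth hq hye
  rw [hpq, ← mul_assoc, hq', hp', mul_assoc]

theorem eq_zero_of_forall_mul (hf : IsZeroProductPreserver α f) {v : V}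
    (h : ∀ a : R, f a v = 0) : v = 0 := by
  obtain ⟨a, ha⟩ := hf.exists_eq v v
  have := h a
  rw [ha, rankOneEnd_apply, smul_eq_zero, inner_self_eq_zero, or_self] at this
  exact this

theorem exists_apply_eq (hf : IsZeroProductPreserver α f) {u : V} (hu : u ≠ 0) (v : V) :
    ∃ b : R, f b u = v := by
  obtain ⟨b, hb⟩ := hf.exists_eq ((inner ℂ u u)⁻¹ • v : V) u
  refine ⟨b, ?_⟩
  rw [hb, rankOneEnd_apply, smul_smul, mul_inv_cancel₀ (inner_self_ne_zero.2 hu), one_smul]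

/-- Multiplication by `x ⊗ y` on `R` is carried by `f` to multiplication by an operator `L`. With a
vector `u ≠ 0` fixed, `L` sends `f b u` to `f (s * b) u`. -/
theorem exists_multiplier (hf : IsZeroProductPreserver α f) (hinf : ¬ FiniteDimensional ℂ V)
    {x y : V} {s : R} (hs : α s = rankOneEnd x y) :
    ∃ L : Module.End ℂ V, (∀ b, f (s * b) = L * f b) ∧ ∀ a, f (a * s) = f a * L := by
  obtain ⟨u, hu, -⟩ := exists_ne_zero_inner_eq_zero hinf (0 : V) 0
  have key := fun a b => hf.map_mul_rankOne hinf hs a b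
  choose g hg using hf.exists_apply_eq hu
  have hL : ∀ a v, f a (f (s * g v) u) = f (a * s) v := by
    intro a v
    rw [← Module.End.mul_apply, ← key, Module.End.mul_apply, hg]
  let L : Module.End ℂ V :=
    { toFun := fun v => f (s * g v) u
      map_add' := fun v w => by
        rw [← sub_eq_zero]
        apply hf.eq_zero_of_forall_mul
        intro a
        rw [map_sub, map_add, hL, hL, hL, map_add, sub_self]
      map_smul' := fun c v => by
        rw [← sub_eq_zero]
        apply hf.eq_zero_of_forall_mul
        intro a
        rw [map_sub, RingHom.id_apply, map_smul, hL, hL, map_smul, sub_self] }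
  have hLa : ∀ a, f (a * s) = f a * L := fun a => LinearMap.ext fun v => (hL a v).symm
  refine ⟨L, fun b => LinearMap.ext fun v => ?_, hLa⟩
  rw [← sub_eq_zero]
  apply hf.eq_zero_of_forall_mul
  intro a
  rw [map_sub, ← Module.End.mul_apply, ← Module.End.mul_apply, ← mul_assoc, ← hLa, key, sub_self]

theorem eq_of_forall_mul_eq (hf : IsZeroProductPreserver α f) {L M : Module.End ℂ V}
    (h : ∀ a, f a * L = f a * M) : L = M := by
  ext v
  rw [← sub_eq_zero]
  apply hf.eq_zero_of_forall_mul
  intro a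
  rw [map_sub, ← Module.End.mul_apply, ← Module.End.mul_apply, h, sub_self]

/-- The map `(x, y) ↦ x ⊗ y` carried over to the target side: a family `L x y` of operators, additive in
`x`, which multiply as the `x ⊗ y` do and through which `f` is a bimodule map. -/
theorem exists_multiplier_family (hf : IsZeroProductPreserver α f)
    (hinf : ¬ FiniteDimensional ℂ V) :
    ∃ (s : V → V → R) (L : V → V → Module.End ℂ V),
      (∀ x y, α (s x y) = rankOneEnd x y) ∧
      (∀ x y b, f (s x y * b) = L x y * f b) ∧
      (∀ x y a, f (a * s x y) = f a * L x y) ∧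
      (∀ x x' y, L (x + x') y = L x y + L x' y) ∧
      (∀ x y z w, L x y * L z w = L (inner ℂ y z • x : V) w) := by
  choose s hs using hf.exists_action_eq
  choose L hL hR using fun x y => hf.exists_multiplier hinf (hs x y)
  refine ⟨s, L, hs, hL, hR, fun x x' y => ?_, fun x y z w => ?_⟩
  · apply hf.eq_of_forall_mul_eq
    intro a
    have : s (x + x') y = s x y + s x' y := hf.injective_action (by
      rw [map_add, hs, hs, hs, rankOneEnd_add_left])
    rw [← hR, this, mul_add, map_add, hR, hR, mul_add]
  · apply hf.eq_of_forall_mul_eq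
    intro a
    have : s (inner ℂ y z • x) w = s x y * s z w := hf.injective_action (by
      rw [map_mul, hs, hs, hs, rankOneEnd_mul])
    rw [← mul_assoc, ← hR, ← hR, ← hR, this, mul_assoc]

/-- An injective additive map preserving zero products is, up to a scalar, conjugation by a
bijection `T` that is semilinear with respect to an automorphism `h` of the field `ℂ`. -/
theorem exists_semilinear (hf : IsZeroProductPreserver α f) (hinf : ¬ FiniteDimensional ℂ V) :
    ∃ (c : ℂ) (h : ℂ ≃+* ℂ) (T : V ≃ V), c ≠ 0 ∧ (∀ x y, T (x + y) = T x + T y) ∧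
      (∀ (a : ℂ) x, T (a • x) = h a • T x) ∧ ∀ a x, f a (T x) = c • T (α a x) := by
  obtain ⟨s, L, hs, hL, hR, hadd, hmul⟩ := hf.exists_multiplier_family hinf
  obtain ⟨x₀, hx₀, hx₁⟩ : ∃ x₀ : V, x₀ ≠ 0 ∧ inner ℂ x₀ x₀ = (1 : ℂ) := by
    obtain ⟨e, he, -⟩ := exists_ne_zero_inner_eq_zero hinf (0 : V) 0
    have hn : ‖((‖e‖⁻¹ : ℝ) : ℂ) • e‖ = 1 := by
      rw [norm_smul, Complex.norm_real, norm_inv, norm_norm, inv_mul_cancel₀ (norm_ne_zero_iff.2 he)]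
    refine ⟨((‖e‖⁻¹ : ℝ) : ℂ) • e, norm_ne_zero_iff.1 (by rw [hn]; exact one_ne_zero), ?_⟩
    rw [inner_self_eq_norm_sq_to_K, hn]
    simp
  -- `Q` is the idempotent corresponding to `x₀ ⊗ x₀`, and `K a` corresponds to `a x₀ ⊗ x₀`.
  set Q := L x₀ x₀ with hQ
  set K : ℂ → Module.End ℂ V := fun a => L (a • x₀) x₀ with hK
  have hLQ : ∀ x, L x x₀ * Q = L x x₀ := fun x => by rw [hQ, hmul, hx₁, one_smul]
  have hQQ : Q * Q = Q := hLQ x₀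
  have hLK : ∀ x a, L x x₀ * K a = L (a • x) x₀ := fun x a => by
    simp only [hK]; rw [hmul, inner_smul_right, hx₁, mul_one]
  have hKone : K 1 = Q := by simp only [hK, one_smul, hQ]
  have hKK : ∀ a b, K a * K b = K (a * b) := fun a b => by
    simp only [hK]; rw [hmul, inner_smul_right, hx₁, mul_one, smul_smul, mul_comm b a]
  have hKadd : ∀ a b, K (a + b) = K a + K b := fun a b => by
    simp only [hK]; rw [add_smul, hadd]
  set p := s x₀ x₀ with hp
  have hpp : p * p = p := hf.injective_action (by
    rw [map_mul, hs, rankOneEnd_mul, hx₁, one_smul])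
  have hp0 : p ≠ 0 := fun h => by
    have h1 := LinearMap.congr_fun (hs x₀ x₀) x₀
    rw [← hp, h, map_zero, rankOneEnd_apply, hx₁, one_smul] at h1
    exact hx₀ h1.symm
  have hfp0 : f p ≠ 0 := fun h => hp0 (hf.injective (h.trans (map_zero f).symm))
  have hQf : Q * f p = f p := by rw [← hL, ← hp, hpp]
  have hfQ : f p * Q = f p := by rw [← hR, ← hp, hpp]
  -- the corner `p R p` consists of the multiples of `p`
  have hcorner : ∀ N : Module.End ℂ V, (∃ r, f r = N) → ∃ a, Q * N * Q = K a * f p := by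
    rintro N ⟨r, rfl⟩
    refine ⟨inner ℂ x₀ (α r x₀), ?_⟩
    simp only [hK, hQ]
    rw [← hL, ← hR, ← hL]
    congr 1
    apply hf.injective_action
    rw [map_mul, map_mul, map_mul, hs, hs, mul_assoc, mul_rankOneEnd, rankOneEnd_mul,
      rankOneEnd_mul, hx₁, one_smul]
  obtain ⟨u, hu0, huQ⟩ : ∃ u, u ≠ 0 ∧ Q u = u := by
    obtain ⟨v, hv⟩ : ∃ v, f p v ≠ 0 := by
      by_contra! hcon
      exact hfp0 (LinearMap.ext hcon)
    exact ⟨f p v, hv, LinearMap.congr_fun hQf v⟩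
  have huu : inner ℂ u u ≠ (0 : ℂ) := inner_self_ne_zero.2 hu0
  -- `Q` has rank one: all nonzero elements of the corner have the same kernel, so `v` below is
  -- annihilated by `Q (u ⊗ v) Q` because it is annihilated by `Q (u ⊗ u) Q`.
  have hrank : ∀ χ, ∃ t : ℂ, Q χ = t • u := by
    intro χ
    set t : ℂ := (inner ℂ u u)⁻¹ * inner ℂ u (Q χ) with ht
    refine ⟨t, ?_⟩
    set v := Q χ - t • u with hv
    have hQv : Q v = v := by
      rw [hv, map_sub, map_smul, huQ, ← Module.End.mul_apply, hQQ]
    have huv : inner ℂ u v = (0 : ℂ) := by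
      rw [hv, inner_sub_right, inner_smul_right, ht, mul_right_comm, inv_mul_cancel₀ huu, one_mul,
        sub_self]
    obtain ⟨a, ha⟩ := hcorner _ (hf.exists_eq u u)
    obtain ⟨b, hb⟩ := hcorner _ (hf.exists_eq u v)
    have hau := LinearMap.congr_fun ha u
    have hav := LinearMap.congr_fun ha v
    have hbv := LinearMap.congr_fun hb v
    simp only [Module.End.mul_apply, huQ, hQv, rankOneEnd_apply, map_smul, huv, zero_smul]
      at hau hav hbv
    have ha0 : a ≠ 0 := by
      rintro rfl
      have : K 0 = 0 := by simpa using hKadd 0 0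
      rw [this, LinearMap.zero_apply, smul_eq_zero] at hau
      exact hau.elim huu hu0
    rw [← div_mul_cancel₀ b ha0, ← hKK, Module.End.mul_apply, ← hav, map_zero, map_zero, smul_eq_zero,
      inner_self_eq_zero] at hbv
    exact sub_eq_zero.1 (hbv.resolve_right hu0)
  have hKu : ∀ a, ∃ t : ℂ, K a u = t • u := by
    intro a
    obtain ⟨t, ht⟩ := hrank (K a u)
    refine ⟨t, ?_⟩
    rw [← ht, ← Module.End.mul_apply, ← hKone, hKK, one_mul]
  choose h₀ hh₀ using hKu
  have cancel : ∀ {a b : ℂ}, a • u = b • u → a = b := fun h => smul_left_injective ℂ hu0 h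
  let h₁ : ℂ →+* ℂ := RingHom.mk'
    { toFun := h₀
      map_one' := cancel (by rw [← hh₀, hKone, huQ, one_smul])
      map_mul' := fun a b => cancel (by
        rw [← hh₀, ← hKK, Module.End.mul_apply, hh₀, map_smul, hh₀, smul_smul, mul_comm]) }
    (fun a b => cancel (by
      change h₀ (a + b) • u = (h₀ a + h₀ b) • u
      rw [← hh₀, hKadd, LinearMap.add_apply, hh₀, hh₀, add_smul]))
  have hh₁ : ∀ a, K a u = h₁ a • u := hh₀
  obtain ⟨c, hc⟩ : ∃ c : ℂ, f p u = c • u := by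
    obtain ⟨c, hc⟩ := hrank (f p u)
    exact ⟨c, by rw [← hc, ← Module.End.mul_apply, hQf]⟩
  have hc0 : c ≠ 0 := by
    rintro rfl
    apply hfp0
    ext χ
    obtain ⟨t, ht⟩ := hrank χ
    rw [← hfQ, Module.End.mul_apply, ht, map_smul, hc, zero_smul, smul_zero, LinearMap.zero_apply]
  have hsurj : Function.Surjective h₁ := by
    intro b
    obtain ⟨a, ha⟩ := hcorner _ (hf.exists_eq ((b * c * (inner ℂ u u)⁻¹) • u : V) u)
    refine ⟨a, ?_⟩
    have hau := LinearMap.congr_fun ha u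
    simp only [Module.End.mul_apply, huQ, rankOneEnd_apply, map_smul, hc, hh₁] at hau
    rw [smul_smul, smul_smul] at hau
    have := cancel hau
    field_simp at this
    exact this.symm
  let h : ℂ ≃+* ℂ := RingEquiv.ofBijective h₁ ⟨h₁.injective, hsurj⟩
  have hh : ∀ a, K a u = h a • u := hh₁
  let T₀ : V →+ V := AddMonoidHom.mk' (fun x => L x x₀ u) fun x y => by
    rw [hadd, LinearMap.add_apply]
  have hT₀ : ∀ x, T₀ x = L x x₀ u := fun _ => rfl
  have hTsmul : ∀ (a : ℂ) x, T₀ (a • x) = h a • T₀ x := fun a x => by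
    rw [hT₀, hT₀, ← hLK, Module.End.mul_apply, hh, map_smul]
  have hTf : ∀ a x, f a (T₀ x) = c • T₀ (α a x) := by
    intro a x
    have h1 : a * s x x₀ = s (α a x) x₀ * p := hf.injective_action (by
      rw [map_mul, map_mul, hs, hs, hs, mul_rankOneEnd, rankOneEnd_mul, hx₁, one_smul])
    rw [hT₀, hT₀, ← Module.End.mul_apply, ← hR, h1, hL, Module.End.mul_apply, hc, map_smul]
  have hTinj : Function.Injective T₀ := by
    rw [injective_iff_map_eq_zero]
    intro x hx
    by_contra hx0
    apply hu0
    have h1 := hmul (((inner ℂ x x)⁻¹ : ℂ) • x₀) x x x₀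
    rw [smul_smul, mul_inv_cancel₀ (inner_self_ne_zero.2 hx0), one_smul] at h1
    rw [← huQ, hQ, ← h1, Module.End.mul_apply, ← hT₀, hx, map_zero]
  have hTsurj : Function.Surjective T₀ := by
    intro v
    obtain ⟨b, hb⟩ := hf.exists_apply_eq hu0 v
    refine ⟨h.symm c • α b x₀, ?_⟩
    have : T₀ x₀ = u := huQ
    rw [hTsmul, RingEquiv.apply_symm_apply, ← hTf, this, hb]
  exact ⟨c, h, Equiv.ofBijective T₀ ⟨hTinj, hTsurj⟩, hc0, map_add T₀, hTsmul, hTf⟩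

/-- If the operators `α a` have adjoints, then so does `T`, up to the automorphism `h`. Apply
`f r T = c T (α r)` to an `r` for which `f r` has rank one, and read off `α r`. -/
theorem exists_inner_eq_of_action_adjoint (hf : IsZeroProductPreserver α f) {c : ℂ} {h : ℂ ≃+* ℂ}
    {T : V ≃ V} (hTs : ∀ (a : ℂ) x, T (a • x) = h a • T x)
    (hTf : ∀ a x, f a (T x) = c • T (α a x))
    (hadj : ∀ a (φ : V), ∃ η : V, ∀ χ, inner ℂ η χ = inner ℂ φ (α a χ)) (w : V) :
    ∃ η : V, ∀ x, h (inner ℂ η x) = inner ℂ w (T x) := by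
  by_cases hw : w = 0
  · exact ⟨0, fun x => by rw [hw, inner_zero_left, inner_zero_left, map_zero]⟩
  have hww : inner ℂ w w ≠ (0 : ℂ) := inner_self_ne_zero.2 hw
  obtain ⟨x₀, rfl⟩ := T.surjective w
  have hx₀ : x₀ ≠ 0 := by
    rintro rfl
    exact hw (by simpa using hTs 0 0)
  have hxx : inner ℂ x₀ x₀ ≠ (0 : ℂ) := inner_self_ne_zero.2 hx₀
  obtain ⟨r, hr⟩ := hf.exists_eq (T x₀) (T x₀)
  obtain ⟨η, hη⟩ := hadj r (((starRingEnd ℂ) (h.symm c * (inner ℂ x₀ x₀)⁻¹)) • x₀)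
  refine ⟨η, fun x => ?_⟩
  have h1 := hTf r x
  rw [hr, rankOneEnd_apply, ← h.apply_symm_apply (inner ℂ (T x₀) (T x)), ← hTs,
    ← h.apply_symm_apply c, ← hTs] at h1
  have h2 := congrArg (inner ℂ x₀) (T.injective h1)
  rw [inner_smul_right, inner_smul_right] at h2
  rw [hη, inner_smul_left, Complex.conj_conj, mul_right_comm, ← h2, mul_inv_cancel_right₀ hxx,
    h.apply_symm_apply]

/-- If the operators `f a` have adjoints, then so does `T⁻¹`, up to the automorphism `h`. -/
theorem exists_inner_eq_of_map_adjoint (hf : IsZeroProductPreserver α f) {c : ℂ} (hc : c ≠ 0)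
    {h : ℂ ≃+* ℂ} {T : V ≃ V} (hTs : ∀ (a : ℂ) x, T (a • x) = h a • T x)
    (hTf : ∀ a x, f a (T x) = c • T (α a x))
    (hadj : ∀ a (φ : V), ∃ η : V, ∀ χ, inner ℂ η χ = inner ℂ φ (f a χ)) (x : V) :
    ∃ η : V, ∀ y, h (inner ℂ x y) = inner ℂ η (T y) := by
  by_cases hx : x = 0
  · exact ⟨0, fun y => by rw [hx, inner_zero_left, inner_zero_left, map_zero]⟩
  have hTx : T x ≠ 0 := by
    have h0 : T 0 = 0 := by simpa using hTs 0 0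
    exact fun h1 => hx (T.injective (h1.trans h0.symm))
  have hxx : c * inner ℂ (T x) (T x) ≠ (0 : ℂ) := mul_ne_zero hc (inner_self_ne_zero.2 hTx)
  obtain ⟨r, hr⟩ := hf.exists_action_eq x x
  obtain ⟨η, hη⟩ := hadj r (((starRingEnd ℂ) (c * inner ℂ (T x) (T x))⁻¹) • T x)
  refine ⟨η, fun y => ?_⟩
  rw [hη, hTf, hr, rankOneEnd_apply, hTs, inner_smul_left, Complex.conj_conj, inner_smul_right,
    inner_smul_right, mul_left_comm c, mul_left_comm, inv_mul_cancel₀ hxx, mul_one]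

end IsZeroProductPreserver

end Algebraic

open Filter Topology

theorem exists_orthonormal_nat {V : Type*} [NormedAddCommGroup V] [InnerProductSpace ℂ V]
    (hinf : ¬ FiniteDimensional ℂ V) : ∃ e : ℕ → V, Orthonormal ℂ e := by
  let b := Module.Basis.ofVectorSpace ℂ V
  have : Infinite (Module.Basis.ofVectorSpaceIndex ℂ V) := by
    by_contra hfin
    rw [not_infinite_iff_finite] at hfin
    exact hinf (Module.Finite.of_basis b)
  exact ⟨_, InnerProductSpace.gramSchmidtNormed_orthonormal
    (b.linearIndependent.comp _ (Infinite.natEmbedding _).injective)⟩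

section Seminorm

variable {E : Type*} [AddCommGroup E] [Module ℂ E]

theorem _root_.Seminorm.tendsto_nhds_iff (p : Seminorm ℂ E) {ι : Type*} {l : Filter ι} {u : ι → E}
    {x : E} :
    Tendsto u l (@nhds E p.toSeminormedAddCommGroup.toUniformSpace.toTopologicalSpace x) ↔
      Tendsto (fun n => p (u n - x)) l (𝓝 0) := by
  let := p.toSeminormedAddCommGroup
  exact tendsto_iff_norm_sub_tendsto_zero

theorem _root_.Seminorm.cauchySeq_sum_range (p : Seminorm ℂ E) {u : ℕ → E}
    (hu : Summable fun n => p (u n)) :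
    @CauchySeq E ℕ p.toSeminormedAddCommGroup.toUniformSpace _
      (fun n => ∑ i ∈ Finset.range n, u i) := by
  let := p.toSeminormedAddCommGroup
  have : CauchySeq fun s : Finset ℕ => ∑ i ∈ s, u i := cauchySeq_finset_of_summable_norm hu
  exact this.comp_tendsto tendsto_finset_range

end Seminorm

/-! ### Series in (F)-domains and continuity of field automorphisms -/

variable {H : Type*} [NormedAddCommGroup H] [InnerProductSpace ℂ H] {D : Submodule ℂ H}

theorem tendsto_graphTopology_iff {ι : Type*} {l : Filter ι} {u : ι → D} {x : D} :
    Tendsto u l (@nhds D (graphTopology D) x) ↔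
      ∀ A : LPlus D, Tendsto (fun n => graphSeminorm A (u n - x)) l (𝓝 0) := by
  rw [graphTopology, UniformSpace.toTopologicalSpace_iInf, nhds_iInf, tendsto_iInf]
  exact forall_congr' fun A => (graphSeminorm A).tendsto_nhds_iff

/-- In an (F)-domain a series converges as soon as each seminorm sums it absolutely. -/
theorem IsFDomain.exists_tendsto_sum (hD : IsFDomain D) {u : ℕ → D}
    (hu : ∀ A : LPlus D, Summable fun n => graphSeminorm A (u n)) :
    ∃ y, Tendsto (fun n => ∑ i ∈ Finset.range n, u i) atTop (@nhds D (graphTopology D) y) := by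
  have hc : @Cauchy D (graphUniformSpace D)
      (map (fun n => ∑ i ∈ Finset.range n, u i) atTop) :=
    cauchy_iInf_uniformSpace.2 fun A => (graphSeminorm A).cauchySeq_sum_range (hu A)
  exact hD.complete.complete hc

/-- Coefficients that decay fast enough, relative to the orthonormal sequence `e`, are the Fourier
coefficients of a vector of the (F)-domain `D`. -/
theorem IsFDomain.exists_forall_inner_eq (hD : IsFDomain D) {e : ℕ → D} (he : Orthonormal ℂ e) :
    ∃ ε : ℕ → ℝ, (∀ n, 0 < ε n) ∧ ∀ a : ℕ → ℂ, (∀ n, ‖a n‖ < ε n) →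
      ∃ y : D, ∀ n, inner ℂ (e n) y = a n := by
  have hcount : (@nhds D (graphTopology D) 0).IsCountablyGenerated :=
    let := graphTopology D
    have := hD.metrizable
    inferInstance
  obtain ⟨U, hU⟩ := (@nhds D (graphTopology D) 0).exists_antitone_basis
  have hε : ∀ n, ∃ ε : ℝ, 0 < ε ∧ ∀ a : ℂ, ‖a‖ < ε → ((2 : ℂ) ^ n * a) • e n ∈ U n := by
    intro n
    have : Tendsto (fun a : ℂ => ((2 : ℂ) ^ n * a) • e n) (𝓝 0) (@nhds D (graphTopology D) 0) := by
      rw [tendsto_graphTopology_iff]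
      intro A
      have : Continuous fun a : ℂ => ‖(2 : ℂ) ^ n * a‖ * graphSeminorm A (e n) := by fun_prop
      simpa [map_smul_eq_mul] using this.tendsto 0
    obtain ⟨ε, hε0, hε⟩ := Metric.mem_nhds_iff.1 (this (hU.1.mem_of_mem trivial : U n ∈ _))
    exact ⟨ε, hε0, fun a ha => hε (by simpa using ha)⟩
  choose ε hε0 hε using hε
  refine ⟨ε, hε0, fun a ha => ?_⟩
  have hsum : ∀ A : LPlus D, Summable fun n => graphSeminorm A (a n • e n) := by
    intro A
    have hball : {φ : D | graphSeminorm A φ < 1} ∈ @nhds D (graphTopology D) 0 := by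
      have := (tendsto_graphTopology_iff (D := D) (x := 0) (u := fun φ : D => φ)).1 tendsto_id A
      simp only [sub_zero] at this
      exact this (Iio_mem_nhds one_pos)
    obtain ⟨N, -, hN⟩ := hU.1.mem_iff.1 hball
    refine Summable.of_norm_bounded_eventually_nat summable_geometric_two ?_
    filter_upwards [eventually_ge_atTop N] with n hn
    have h1 : graphSeminorm A (((2 : ℂ) ^ n * a n) • e n) < 1 := hN (hU.2 hn (hε n _ (ha n)))
    rw [mul_smul, map_smul_eq_mul, norm_pow, Complex.norm_ofNat] at h1
    rw [Real.norm_of_nonneg (apply_nonneg _ _), div_pow, one_pow, le_div_iff₀' (by positivity)]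
    exact h1.le
  obtain ⟨y, hy⟩ := hD.exists_tendsto_sum hsum
  refine ⟨y, fun n => ?_⟩
  -- the seminorm of the identity operator is the norm of `H`
  have hnorm : Tendsto (fun n => ∑ i ∈ Finset.range n, a i • e i) atTop (𝓝 y) :=
    tendsto_iff_norm_sub_tendsto_zero.2 (tendsto_graphTopology_iff.1 hy 1)
  have h1 := (tendsto_const_nhds (x := e n)).inner (𝕜 := ℂ) hnorm
  refine tendsto_nhds_unique h1 (tendsto_const_nhds.congr' ?_)
  filter_upwards [eventually_gt_atTop n] with m hm
  exact (he.inner_right_sum a (Finset.mem_range.2 hm)).symm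

/-- A field endomorphism `h` of `ℂ` is continuous once `h ⟪x, y⟫ = ⟪S x, T y⟫` for maps `S`, `T` of an
infinite-dimensional (F)-domain: if `h` were unbounded near `0`, some `y` would have Fourier
coefficients `a n` with `|h (a n)|` too large for the bound `‖S (e n)‖ ‖T y‖`. -/
theorem IsFDomain.ringHom_eq_id_or_conj (hD : IsFDomain D) (hinf : ¬ FiniteDimensional ℂ D)
    (h : ℂ →+* ℂ) (T S : D → D) (hTS : ∀ x y : D, h (inner ℂ x y) = inner ℂ (S x) (T y)) :
    h = RingHom.id ℂ ∨ h = starRingEnd ℂ := by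
  suffices hb : ∃ ε > 0, ∃ M : ℝ, ∀ a : ℂ, ‖a‖ < ε → ‖h a‖ ≤ M by
    obtain ⟨ε, hε, M, hM⟩ := hb
    refine Complex.ringHom_eq_id_or_conj_of_continuous
      (h.toAddMonoidHom.continuous_of_isBounded_nhds_zero (Metric.ball_mem_nhds 0 hε) ?_)
    refine (Metric.isBounded_closedBall (x := (0 : ℂ)) (r := M)).subset ?_
    rintro _ ⟨a, ha, rfl⟩
    simpa using hM a (by simpa using ha)
  by_contra! hcon
  obtain ⟨e, he⟩ := exists_orthonormal_nat hinf
  obtain ⟨ε, hε, hy⟩ := hD.exists_forall_inner_eq he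
  choose a ha hla using fun n : ℕ => hcon (ε n) (hε n) (n * ‖S (e n)‖)
  obtain ⟨y, hy⟩ := hy a ha
  obtain ⟨n, hn⟩ := exists_nat_ge ‖T y‖
  have h1 : ‖h (a n)‖ ≤ ‖S (e n)‖ * ‖T y‖ := by
    rw [← hy, hTS]
    exact norm_inner_le_norm _ _
  have h2 : ‖S (e n)‖ * ‖T y‖ ≤ n * ‖S (e n)‖ := by
    rw [mul_comm]
    gcongr
  exact absurd (h1.trans h2) (not_le.2 (hla n))

/-! ### Standard algebras as rings of operators -/

theorem IsStandard.exists_eq_rankOneEnd {𝒜 : NonUnitalStarSubalgebra ℂ (LPlus D)}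
    (h𝒜 : IsStandard 𝒜) (x y : D) :
    ∃ A : 𝒜, ((A : LPlus D) : Module.End ℂ D) = rankOneEnd x y := by
  refine ⟨⟨⟨rankOneEnd x y, fun φ => ⟨inner ℂ x φ • y, fun χ => ?_⟩⟩, h𝒜 _ ?_⟩, rfl⟩
  · change inner ℂ (inner ℂ x φ • y) χ = inner ℂ φ (inner ℂ y χ • x)
    rw [inner_smul_left, inner_smul_right, inner_conj_symm, mul_comm]
  · have : LinearMap.range (rankOneEnd x y) ≤ Submodule.span ℂ {x} := by
      rintro _ ⟨χ, rfl⟩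
      exact Submodule.smul_mem _ _ (Submodule.mem_span_singleton_self x)
    exact Submodule.finiteDimensional_of_le this

/-- The operators on `D` that belong to a *-subalgebra `𝒜` of `L⁺(D)`, as a ring of endomorphisms of
the vector space `D`. It carries the instance `NonUnitalRing`, which is not found for `𝒜` itself. -/
def operatorRing (𝒜 : NonUnitalStarSubalgebra ℂ (LPlus D)) :
    NonUnitalSubring (Module.End ℂ D) where
  carrier := {A | ∃ h : A ∈ LPlus D, (⟨A, h⟩ : LPlus D) ∈ 𝒜}
  zero_mem' := ⟨zero_mem _, 𝒜.zero_mem'⟩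
  add_mem' := fun ⟨hA, hA'⟩ ⟨hB, hB'⟩ => ⟨add_mem hA hB, 𝒜.add_mem' hA' hB'⟩
  mul_mem' := fun ⟨hA, hA'⟩ ⟨hB, hB'⟩ => ⟨mul_mem hA hB, 𝒜.mul_mem' hA' hB'⟩
  neg_mem' := fun {A} ⟨hA, hA'⟩ => ⟨neg_mem hA, by
    have : (⟨-A, neg_mem hA⟩ : LPlus D) = (-1 : ℂ) • (⟨A, hA⟩ : LPlus D) :=
      Subtype.ext (neg_one_smul ℂ A).symm
    rw [this]
    exact 𝒜.smul_mem' (-1) hA'⟩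

/-- Elements of `operatorRing 𝒜` are the elements of `𝒜`, viewed as endomorphisms of `D`. -/
def operatorRingEquiv (𝒜 : NonUnitalStarSubalgebra ℂ (LPlus D)) : operatorRing 𝒜 ≃ 𝒜 where
  toFun A := ⟨⟨A, A.2.fst⟩, A.2.snd⟩
  invFun A := ⟨(A : LPlus D), (A : LPlus D).2, A.2⟩

theorem coe_coe_injective (𝒜 : NonUnitalStarSubalgebra ℂ (LPlus D)) :
    Function.Injective fun A : 𝒜 => ((A : LPlus D) : Module.End ℂ D) :=
  Subtype.val_injective.comp Subtype.val_injective

end UnboundedOp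

set_option maxHeartbeats 2000000 in
open UnboundedOp in
theorem theorem2p1 {H : Type*} [NormedAddCommGroup H] [InnerProductSpace ℂ H] [CompleteSpace H]
    (D : Submodule ℂ H) (hD : UnboundedOp.IsFDomain D) (hinf : ¬ FiniteDimensional ℂ D)
    (𝒜 ℬ : NonUnitalStarSubalgebra ℂ (UnboundedOp.LPlus D))
    (h𝒜 : UnboundedOp.IsStandard 𝒜) (hℬ : UnboundedOp.IsStandard ℬ)
    (Φ : 𝒜 → ℬ) (hadd : ∀ X Y : 𝒜, Φ (X + Y) = Φ X + Φ Y) (hbij : Function.Bijective Φ)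
    (hzero : ∀ X Y : 𝒜, X * Y = 0 → Φ X * Φ Y = 0) :
    ∃ (c : ℂ) (T : D ≃ D) (Ψ : 𝒜 ≃+* ℬ),
      (IsLinearMap ℂ T ∨ UnboundedOp.IsConjLinear T) ∧
      (∀ hT : IsLinearMap ℂ T, IsLinearMap.mk' T hT ∈ UnboundedOp.LPlus D) ∧
      (∀ (A : 𝒜) (φ : D), ((Ψ A : UnboundedOp.LPlus D) : Module.End ℂ D) φ
        = T (((A : UnboundedOp.LPlus D) : Module.End ℂ D) (T.symm φ))) ∧
      (∀ A : 𝒜, (Φ A : UnboundedOp.LPlus D) = c • (Ψ A : UnboundedOp.LPlus D)) ∧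
      (∀ (A : 𝒜) (φ : D), ((Φ A : UnboundedOp.LPlus D) : Module.End ℂ D) φ
        = c • T (((A : UnboundedOp.LPlus D) : Module.End ℂ D) (T.symm φ))) := by
  let toA := operatorRingEquiv 𝒜
  let α : operatorRing 𝒜 →ₙ+* Module.End ℂ D := NonUnitalSubringClass.subtype (operatorRing 𝒜)
  let f : operatorRing 𝒜 →+ Module.End ℂ D :=
    AddMonoidHom.mk' (fun A => ((Φ (toA A) : LPlus D) : Module.End ℂ D)) fun A B =>
      congrArg (fun C : ℬ => ((C : LPlus D) : Module.End ℂ D)) (hadd (toA A) (toA B))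
  have hf : IsZeroProductPreserver α f :=
    { injective_action := Subtype.val_injective
      injective := fun A B hAB =>
        toA.injective (hbij.1 (coe_coe_injective ℬ hAB))
      exists_action_eq := fun x y => by
        obtain ⟨A, hA⟩ := h𝒜.exists_eq_rankOneEnd x y
        exact ⟨toA.symm A, hA⟩
      exists_eq := fun x y => by
        obtain ⟨B, hB⟩ := hℬ.exists_eq_rankOneEnd x y
        obtain ⟨A, rfl⟩ := hbij.2 B
        exact ⟨toA.symm A, hB⟩
      map_mul_eq_zero := fun A B hAB => by
        have h1 : (toA A) * (toA B) = 0 :=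
          coe_coe_injective 𝒜 (congrArg (fun C : operatorRing 𝒜 => (C : Module.End ℂ D)) hAB)
        exact congrArg (fun C : ℬ => ((C : LPlus D) : Module.End ℂ D)) (hzero _ _ h1) }
  obtain ⟨c, h, T, hc, hTadd, hTs, hTf⟩ := hf.exists_semilinear hinf
  have hΦ : ∀ (A : 𝒜) (φ : D), ((Φ A : LPlus D) : Module.End ℂ D) φ
      = c • T (((A : LPlus D) : Module.End ℂ D) (T.symm φ)) := by
    intro A φ
    conv_lhs => rw [← T.apply_symm_apply φ]
    exact hTf (toA.symm A) _
  -- `Ψ` is `c⁻¹ Φ`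
  let m : ℂ → ℬ → ℬ := fun a B => ⟨a • (B : LPlus D), ℬ.smul_mem' a B.2⟩
  let μ : ℬ ≃ ℬ :=
    { toFun := m c⁻¹
      invFun := m c
      left_inv := fun B => Subtype.ext (smul_inv_smul₀ hc (B : LPlus D))
      right_inv := fun B => Subtype.ext (inv_smul_smul₀ hc (B : LPlus D)) }
  have hΨ : ∀ (A : 𝒜) (φ : D), ((μ (Φ A) : LPlus D) : Module.End ℂ D) φ
      = T (((A : LPlus D) : Module.End ℂ D) (T.symm φ)) := by
    intro A φ
    change c⁻¹ • ((Φ A : LPlus D) : Module.End ℂ D) φ = _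
    rw [hΦ, inv_smul_smul₀ hc]
  let Ψ : 𝒜 ≃+* ℬ :=
    { toEquiv := (Equiv.ofBijective Φ hbij).trans μ
      map_add' := fun X Y => by
        apply coe_coe_injective ℬ
        ext1 φ
        refine (hΨ (X + Y) φ).trans (Eq.trans ?_ (congrArg₂ (· + ·) (hΨ X φ) (hΨ Y φ)).symm)
        exact hTadd _ _
      map_mul' := fun X Y => by
        apply coe_coe_injective ℬ
        ext1 φ
        have h1 := hΨ X (((μ (Φ Y) : LPlus D) : Module.End ℂ D) φ)
        rw [hΨ Y, T.symm_apply_apply] at h1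
        refine (hΨ (X * Y) φ).trans (Eq.trans h1.symm ?_)
        rw [← hΨ Y]
        rfl }
  choose S hS using hf.exists_inner_eq_of_map_adjoint hc hTs hTf
    fun A φ => (Φ (toA A) : LPlus D).2 φ
  refine ⟨c, T, Ψ, ?_, fun hT => ?_, hΨ, fun A => (smul_inv_smul₀ hc (Φ A : LPlus D)).symm, hΦ⟩
  · rcases hD.ringHom_eq_id_or_conj hinf (h : ℂ →+* ℂ) T S hS with hid | hconj
    · refine Or.inl ⟨hTadd, fun a x => ?_⟩
      rw [hTs]
      exact congrArg (· • T x) (RingHom.congr_fun hid a)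
    · refine Or.inr ⟨hTadd, fun a x => ?_⟩
      rw [hTs]
      exact congrArg (· • T x) (RingHom.congr_fun hconj a)
  · intro φ
    obtain ⟨η, hη⟩ :=
      hf.exists_inner_eq_of_action_adjoint hTs hTf (fun A φ => A.2.fst φ) φ
    refine ⟨η, fun χ => ?_⟩
    -- the adjoint relation holds up to `h`, and a linear `T` forces `h = id`, since `D ≠ 0`
    obtain ⟨x, hx, -⟩ := exists_ne_zero_inner_eq_zero hinf 0 0
    have hid : ∀ a, h a = a := fun a => by
      have hy : T (T.symm x) = x := T.apply_symm_apply x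
      have h1 := (hTs a (T.symm x)).symm.trans (hT.map_smul a (T.symm x))
      rw [hy] at h1
      exact smul_left_injective ℂ hx h1
    exact (hid _).symm.trans (hη χ)
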